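/- Let $(M,g)$ be a smooth Lorentzian manifold of dimension $n\ge 2$ and signature $(-,+,\dots,+)$, with Levi-Civita connection $\nabla$, and let $Z$ be a smooth, nontrivial vector field on $M$ which is covariantly constant and null, that is, $\nabla Z=0$ and $g(Z,Z)=0$. Let $\varphi=(u,v,x^1,\dots,x^{n-2})$ be a smooth local coordinate chart with domain $U\subseteq M$ which is adapted to $Z$, that is, $$Z|_U=\partial_v=\operatorname{grad} u ,$$ where $\operatorname{grad}u$ is the vector field with $g(\operatorname{grad} u,\cdot)=du$. Write $g_{\sigma\rho}=g(\partial_\sigma,\partial_\rho)$ for the metric components in this chart, where $\sigma,\rho$ run over all coordinates $u,v,x^1,\dots,x^{n-2}$, and let $a,b\in\{1,\dots,n-2\}$ refer to the coordinates $x^1,\dots,x^{n-2}$ only. Then the following hold on $U$. 1. All metric components are independent of $v$, in the sense that $\partial_v(g_{\sigma\rho})=0$ for all $\sigma,\rho$. 2. $g_{v\sigma}=\delta^u_\sigma$ for all $\sigma$, that is, $g_{vu}=1$, $g_{vv}=0$ and $g_{va}=0$ for all $a$. 3. The matrix $(g_{ab})_{1\le a,b\le n-2}$ is positive definite at every point of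 $U$; and for all constants $c,d\in\mathbb R$ the set $\{p\in U : u(p)=c,\ v(p)=d\}$ is a smooth embedded submanifold of $M$ of codimension $2$ on which $g$ induces a smooth Riemannian metric. -/

import Mathlib

open Bundle
open scoped Manifold ContDiff

noncomputable section

/-- A smooth Lorentzian metric of signature `(-, +, …, +)` on a manifold `M`. -/
structure LorentzianMetric {E : Type*} [NormedAddCommGroup E] [NormedSpace ℝ E]
    {H : Type*} [TopologicalSpace H] (I : ModelWithCorners ℝ E H)
    (M : Type*) [TopologicalSpace M] [ChartedSpace H M] [IsManifold I ∞ M] where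
  val (x : M) : TangentSpace I x →L[ℝ] TangentSpace I x →L[ℝ] ℝ
  symm (x : M) (v w : TangentSpace I x) : val x v w = val x w v
  /-- Every tangent space has a basis that is orthonormal for the metric, with exactly one
  vector of square `-1`. -/
  signature (x : M) : ∃ (k : ℕ) (b : Module.Basis (Fin (k + 1)) ℝ (TangentSpace I x)),
    ∀ i j, val x (b i) (b j) = if i = j then (if i = 0 then -1 else 1) else 0
  contMDiff : ContMDiff I (I.prod 𝓘(ℝ, E →L[ℝ] E →L[ℝ] ℝ)) ∞
    (fun x ↦ TotalSpace.mk' (E →L[ℝ] E →L[ℝ] ℝ)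
      (E := fun x : M ↦ TangentSpace I x →L[ℝ] TangentSpace I x →L[ℝ] ℝ) x (val x))

namespace LorentzianMetric

variable {E : Type*} [NormedAddCommGroup E] [NormedSpace ℝ E]
  {H : Type*} [TopologicalSpace H] {I : ModelWithCorners ℝ E H}
  {M : Type*} [TopologicalSpace M] [ChartedSpace H M] [IsManifold I ∞ M]
  (g : LorentzianMetric I M)

/-- The bilinear form of the metric on a single tangent space. -/
def bilin (x : M) : LinearMap.BilinForm ℝ (TangentSpace I x) :=
  LinearMap.mk₂ ℝ (fun v w ↦ g.val x v w) (by simp) (by simp) (by simp) (by simp)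

@[simp]
lemma bilin_apply (x : M) (v w : TangentSpace I x) : g.bilin x v w = g.val x v w := rfl

lemma eq_zero_of_forall (x : M) (v : TangentSpace I x) (h : ∀ w, g.val x v w = 0) : v = 0 := by
  obtain ⟨k, b, hb⟩ := g.signature x
  apply b.ext_elem
  intro i
  have h1 := h (b i)
  rw [← b.sum_repr v] at h1
  simp only [map_sum, sum_apply, map_smul, smul_apply, hb, smul_eq_mul] at h1
  simp only [mul_ite, mul_zero, Finset.sum_ite_eq', Finset.mem_univ, if_true] at h1
  split_ifs at h1 <;> simpa using h1

lemma bilin_nondegenerate (x : M) : (g.bilin x).Nondegenerate := by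
  refine ⟨fun v h ↦ g.eq_zero_of_forall x v h, fun v h ↦ g.eq_zero_of_forall x v fun w ↦ ?_⟩
  rw [g.symm]; exact h w

lemma mdiffAt_val {x : M} {X Y : Π x : M, TangentSpace I x}
    (hX : MDiffAt (T% X) x) (hY : MDiffAt (T% Y) x) :
    MDiffAt (fun y ↦ g.val y (X y) (Y y)) x := by
  have : MDifferentiableAt I (I.prod 𝓘(ℝ))
      (fun m ↦ TotalSpace.mk' ℝ (E := Bundle.Trivial M ℝ) m (g.val m (X m) (Y m))) x := by
    apply MDifferentiableAt.clm_bundle_apply₂ (F₁ := E) (F₂ := E)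
    · exact g.contMDiff.mdifferentiableAt (by simp)
    · exact hX
    · exact hY
  simp only [mdifferentiableAt_totalSpace] at this
  exact this.2

lemma ext_of_val {x : M} {A B : TangentSpace I x →L[ℝ] TangentSpace I x}
    (h : ∀ X Y : Π x : M, TangentSpace I x, MDiffAt (T% X) x → MDiffAt (T% Y) x →
      g.val x (A (X x)) (Y x) = g.val x (B (X x)) (Y x)) : A = B := by
  ext v
  rw [← sub_eq_zero]
  refine g.eq_zero_of_forall x _ fun w ↦ ?_
  have := h (FiberBundle.extend E v) (FiberBundle.extend E w)
    (FiberBundle.mdifferentiableAt_extend ..) (FiberBundle.mdifferentiableAt_extend ..)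
  simpa [sub_eq_zero] using this

variable [FiniteDimensional ℝ E]

/-- The musical isomorphism `♯`, characterized by `g (♯ α) w = α w` for every `w`. -/
def sharp (x : M) : (TangentSpace I x →L[ℝ] ℝ) →L[ℝ] TangentSpace I x :=
  haveI : FiniteDimensional ℝ (TangentSpace I x) := inferInstanceAs (FiniteDimensional ℝ E)
  LinearMap.toContinuousLinearMap
    { toFun := fun α ↦ ((g.bilin x).toDual (g.bilin_nondegenerate x)).symm α.toLinearMap
      map_add' := fun α β ↦ by simp
      map_smul' := fun c α ↦ by simp }

lemma val_sharp (x : M) (α : TangentSpace I x →L[ℝ] ℝ) (w : TangentSpace I x) :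
    g.val x (g.sharp x α) w = α w :=
  haveI : FiniteDimensional ℝ (TangentSpace I x) := inferInstanceAs (FiniteDimensional ℝ E)
  LinearMap.BilinForm.apply_toDual_symm_apply (B := g.bilin x) (hB := g.bilin_nondegenerate x)
    α.toLinearMap w

/-- The gradient of a real function: `g (grad f) w = df w`. -/
def grad (f : M → ℝ) (x : M) : TangentSpace I x := g.sharp x (d% f x)

open VectorField

/-- The right-hand side of the Koszul formula for `2 g(∇_X σ, Y)`. -/
def koszul (σ X Y : Π x : M, TangentSpace I x) (x : M) : ℝ :=
  d% (fun y ↦ g.val y (σ y) (Y y)) x (X x) + d% (fun y ↦ g.val y (X y) (Y y)) x (σ x)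
    - d% (fun y ↦ g.val y (X y) (σ y)) x (Y x)
    + g.val x (mlieBracket I X σ x) (Y x) - g.val x (mlieBracket I X Y x) (σ x)
    - g.val x (mlieBracket I σ Y x) (X x)

variable {g} in
lemma koszul_tensorial₁ {x : M} {σ Y : Π x : M, TangentSpace I x}
    (hσ : MDiffAt (T% σ) x) (hY : MDiffAt (T% Y) x) :
    TensorialAt I E (fun X ↦ g.koszul σ X Y x) x where
  smul {f X} hf hX := by
    have e1 : (fun y ↦ g.val y ((f • X) y) (Y y)) = f * fun y ↦ g.val y (X y) (Y y) := by
      ext y; simp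
    have e2 : (fun y ↦ g.val y ((f • X) y) (σ y)) = f * fun y ↦ g.val y (X y) (σ y) := by
      ext y; simp
    simp only [koszul, e1, e2, mvfderiv_mul hf (g.mdiffAt_val hX hY),
      mvfderiv_mul hf (g.mdiffAt_val hX hσ), mlieBracket_smul_left hf hX]
    simp
    rw [g.symm x (X x) (Y x), g.symm x (X x) (σ x)]
    ring
  add {X X'} hX hX' := by
    have e1 : (fun y ↦ g.val y ((X + X') y) (Y y)) = (fun y ↦ g.val y (X y) (Y y)) +
        fun y ↦ g.val y (X' y) (Y y) := by
      ext y; simp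
    have e2 : (fun y ↦ g.val y ((X + X') y) (σ y)) = (fun y ↦ g.val y (X y) (σ y)) +
        fun y ↦ g.val y (X' y) (σ y) := by
      ext y; simp
    simp only [koszul, e1, e2, mvfderiv_add (g.mdiffAt_val hX hY) (g.mdiffAt_val hX' hY),
      mvfderiv_add (g.mdiffAt_val hX hσ) (g.mdiffAt_val hX' hσ), mlieBracket_add_left hX hX']
    simp
    ring

variable {g} in
lemma koszul_tensorial₂ {x : M} {σ X : Π x : M, TangentSpace I x}
    (hσ : MDiffAt (T% σ) x) (hX : MDiffAt (T% X) x) :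
    TensorialAt I E (fun Y ↦ g.koszul σ X Y x) x where
  smul {f Y} hf hY := by
    have e1 : (fun y ↦ g.val y (σ y) ((f • Y) y)) = f * fun y ↦ g.val y (σ y) (Y y) := by
      ext y; simp
    have e2 : (fun y ↦ g.val y (X y) ((f • Y) y)) = f * fun y ↦ g.val y (X y) (Y y) := by
      ext y; simp
    simp only [koszul, e1, e2, mvfderiv_mul hf (g.mdiffAt_val hσ hY),
      mvfderiv_mul hf (g.mdiffAt_val hX hY), mlieBracket_smul_right hf hY]
    simp
    rw [g.symm x (Y x) (X x), g.symm x (Y x) (σ x)]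
    ring
  add {Y Y'} hY hY' := by
    have e1 : (fun y ↦ g.val y (σ y) ((Y + Y') y)) = (fun y ↦ g.val y (σ y) (Y y)) +
        fun y ↦ g.val y (σ y) (Y' y) := by
      ext y; simp
    have e2 : (fun y ↦ g.val y (X y) ((Y + Y') y)) = (fun y ↦ g.val y (X y) (Y y)) +
        fun y ↦ g.val y (X y) (Y' y) := by
      ext y; simp
    simp only [koszul, e1, e2, mvfderiv_add (g.mdiffAt_val hσ hY) (g.mdiffAt_val hσ hY'),
      mvfderiv_add (g.mdiffAt_val hX hY) (g.mdiffAt_val hX hY'), mlieBracket_add_right hY hY']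
    simp
    ring

variable {g} in
lemma koszul_add {x : M} {σ σ' X Y : Π x : M, TangentSpace I x}
    (hσ : MDiffAt (T% σ) x) (hσ' : MDiffAt (T% σ') x)
    (hX : MDiffAt (T% X) x) (hY : MDiffAt (T% Y) x) :
    g.koszul (σ + σ') X Y x = g.koszul σ X Y x + g.koszul σ' X Y x := by
  have e1 : (fun y ↦ g.val y ((σ + σ') y) (Y y)) = (fun y ↦ g.val y (σ y) (Y y)) +
      fun y ↦ g.val y (σ' y) (Y y) := by
    ext y; simp
  have e2 : (fun y ↦ g.val y (X y) ((σ + σ') y)) = (fun y ↦ g.val y (X y) (σ y)) +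
      fun y ↦ g.val y (X y) (σ' y) := by
    ext y; simp
  simp only [koszul, e1, e2, mvfderiv_add (g.mdiffAt_val hσ hY) (g.mdiffAt_val hσ' hY),
    mvfderiv_add (g.mdiffAt_val hX hσ) (g.mdiffAt_val hX hσ'), mlieBracket_add_right hσ hσ',
    mlieBracket_add_left hσ hσ']
  simp
  ring

variable {g} in
lemma koszul_smul {x : M} {f : M → ℝ} {σ X Y : Π x : M, TangentSpace I x}
    (hf : MDiffAt f x) (hσ : MDiffAt (T% σ) x)
    (hX : MDiffAt (T% X) x) (hY : MDiffAt (T% Y) x) :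
    g.koszul (f • σ) X Y x =
      f x * g.koszul σ X Y x + 2 * (d% f x (X x) * g.val x (σ x) (Y x)) := by
  have e1 : (fun y ↦ g.val y ((f • σ) y) (Y y)) = f * fun y ↦ g.val y (σ y) (Y y) := by
    ext y; simp
  have e2 : (fun y ↦ g.val y (X y) ((f • σ) y)) = f * fun y ↦ g.val y (X y) (σ y) := by
    ext y; simp
  simp only [koszul, e1, e2, mvfderiv_mul hf (g.mdiffAt_val hσ hY),
    mvfderiv_mul hf (g.mdiffAt_val hX hσ), mlieBracket_smul_right hf hσ,
    mlieBracket_smul_left hf hσ]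
  simp
  rw [g.symm x (X x) (σ x)]
  ring

open Classical in
/-- The Levi-Civita covariant derivative as a bare function, given by the Koszul formula
`2 g(∇_X σ, Y) = koszul σ X Y` (and by `0` at points where `σ` is not differentiable). -/
def leviCivitaFun (σ : Π x : M, TangentSpace I x) (x : M) :
    TangentSpace I x →L[ℝ] TangentSpace I x :=
  if hσ : MDiffAt (T% σ) x then
    (1 / 2 : ℝ) • g.sharp x ∘L TensorialAt.mkHom₂ (I := I) (F := E) (F' := E)
      (fun X Y ↦ g.koszul σ X Y x) x
      (fun _ hY ↦ koszul_tensorial₁ hσ hY) (fun _ hX ↦ koszul_tensorial₂ hσ hX)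
  else 0

lemma val_leviCivitaFun {x : M} {σ X Y : Π x : M, TangentSpace I x}
    (hσ : MDiffAt (T% σ) x) (hX : MDiffAt (T% X) x) (hY : MDiffAt (T% Y) x) :
    g.val x (g.leviCivitaFun σ x (X x)) (Y x) = g.koszul σ X Y x / 2 := by
  have h1 : TensorialAt.mkHom₂ (I := I) (F := E) (F' := E)
      (fun X Y ↦ g.koszul σ X Y x) x
      (fun _ hY ↦ koszul_tensorial₁ hσ hY) (fun _ hX ↦ koszul_tensorial₂ hσ hX) (X x) (Y x) =
      g.koszul σ X Y x := TensorialAt.mkHom₂_apply _ _ hX hY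
  rw [leviCivitaFun, dif_pos hσ, ← h1]
  simp only [smul_apply, map_smul, ContinuousLinearMap.comp_apply]
  change (1 / 2 : ℝ) • g.val x (g.sharp x _) (Y x) = _
  rw [val_sharp, smul_eq_mul]
  ring

/-- The Levi-Civita connection of a Lorentzian metric. -/
def leviCivita : CovariantDerivative I E (TangentSpace I : M → Type _) where
  toFun := g.leviCivitaFun
  isCovariantDerivativeOnUniv :=
    { add := fun {σ σ' x} hσ hσ' _ ↦ g.ext_of_val fun X Y hX hY ↦ by
        rw [g.val_leviCivitaFun (mdifferentiableAt_add_section hσ hσ') hX hY,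
          koszul_add hσ hσ' hX hY]
        simp only [add_apply, map_add]
        rw [g.val_leviCivitaFun hσ hX hY, g.val_leviCivitaFun hσ' hX hY]
        ring
      leibniz := fun {σ f x} hσ hf _ ↦ g.ext_of_val fun X Y hX hY ↦ by
        rw [g.val_leviCivitaFun (hf.smul_section hσ) hX hY, koszul_smul hf hσ hX hY]
        simp only [add_apply, map_add, smul_apply, map_smul,
          ContinuousLinearMap.smulRight_apply]
        rw [g.val_leviCivitaFun hσ hX hY]
        simp only [smul_eq_mul]
        ring }

/-- The Levi-Civita connection is torsion-free. -/
lemma leviCivita_torsion : g.leviCivita.torsion = 0 := by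
  rw [CovariantDerivative.torsion_eq_zero_iff]
  intro X Y x hX hY
  rw [← sub_eq_zero]
  refine g.eq_zero_of_forall x _ fun w ↦ ?_
  have hW : MDiffAt (T% (FiberBundle.extend E w)) x := FiberBundle.mdifferentiableAt_extend ..
  have h1 := g.val_leviCivitaFun hY hX hW
  have h2 := g.val_leviCivitaFun hX hY hW
  simp only [FiberBundle.extend_apply_self] at h1 h2
  simp only [map_sub, sub_apply]
  change g.val x (g.leviCivitaFun Y x (X x)) w - g.val x (g.leviCivitaFun X x (Y x)) w - _ = 0
  rw [h1, h2]
  have e : (fun y ↦ g.val y (Y y) (X y)) = fun y ↦ g.val y (X y) (Y y) := by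
    ext y; exact g.symm _ _ _
  simp only [koszul, e, mlieBracket_swap_apply (V := Y) (W := X)]
  simp
  ring

/-- The Levi-Civita connection is compatible with the metric. -/
lemma leviCivita_metric {x : M} {X σ τ : Π x : M, TangentSpace I x}
    (hX : MDiffAt (T% X) x) (hσ : MDiffAt (T% σ) x) (hτ : MDiffAt (T% τ) x) :
    d% (fun y ↦ g.val y (σ y) (τ y)) x (X x) =
      g.val x (g.leviCivita σ x (X x)) (τ x) + g.val x (σ x) (g.leviCivita τ x (X x)) := by
  rw [g.symm x (σ x)]
  change _ = g.val x (g.leviCivitaFun σ x (X x)) (τ x) + g.val x (g.leviCivitaFun τ x (X x)) (σ x)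
  rw [g.val_leviCivitaFun hσ hX hτ, g.val_leviCivitaFun hτ hX hσ]
  have e : (fun y ↦ g.val y (τ y) (σ y)) = fun y ↦ g.val y (σ y) (τ y) := by
    ext y; exact g.symm _ _ _
  simp only [koszul, e, mlieBracket_swap_apply (V := τ) (W := σ)]
  simp
  ring

end LorentzianMetric

/-- The coordinate vector field `∂_σ` of a chart `φ`, i.e. the push-forward of the `σ`-th standard
basis vector under `φ⁻¹`; meaningful for `x ∈ φ.source`. -/
def coordVector {n : ℕ} {M : Type*} [TopologicalSpace M]
    [ChartedSpace (EuclideanSpace ℝ (Fin n)) M]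
    (φ : OpenPartialHomeomorph M (EuclideanSpace ℝ (Fin n))) (σ : Fin n) (x : M) :
    TangentSpace (𝓡 n) x :=
  mfderiv (𝓡 n) (𝓡 n) φ.symm (φ x) (EuclideanSpace.single σ (1 : ℝ))

namespace LorentzianMetric

variable {n : ℕ} {M : Type*} [TopologicalSpace M] [ChartedSpace (EuclideanSpace ℝ (Fin n)) M]
  [IsManifold (𝓡 n) ∞ M]

/-- The metric component `g_{σρ} = g(∂_σ, ∂_ρ)` in the chart `φ`. -/
def component (g : LorentzianMetric (𝓡 n) M)
    (φ : OpenPartialHomeomorph M (EuclideanSpace ℝ (Fin n))) (σ ρ : Fin n) (x : M) : ℝ :=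
  g.val x (coordVector φ σ x) (coordVector φ ρ x)

/-- The subset `S` of `M` is a smooth embedded submanifold of dimension `k`, and the metric `g`
restricts to a smooth Riemannian metric on it. -/
def IsRiemannianSubmanifold (g : LorentzianMetric (𝓡 n) M) (k : ℕ) (S : Set M) : Prop :=
  ∃ (_ : ChartedSpace (EuclideanSpace ℝ (Fin k)) S) (_ : IsManifold (𝓡 k) ∞ S),
    Manifold.IsSmoothEmbedding (𝓡 k) (𝓡 n) ∞ (Subtype.val : S → M) ∧
    ∃ h : ContMDiffRiemannianMetric (𝓡 k) ∞ (EuclideanSpace ℝ (Fin k))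
        (TangentSpace (𝓡 k) : S → Type _),
      ∀ (p : S) (v w : TangentSpace (𝓡 k) p),
        h.inner p v w = g.val (p : M)
          (mfderiv (𝓡 k) (𝓡 n) (Subtype.val : S → M) p v)
          (mfderiv (𝓡 k) (𝓡 n) (Subtype.val : S → M) p w)

end LorentzianMetric

/-- The chart `φ = (u, v, x¹, …, xᵐ)` is adapted to `Z`, i.e. `Z = ∂_v = grad u` on its domain.
The coordinates `u`, `v`, `xᵃ` have the indices `0`, `1`, `a.succ.succ`. -/
structure IsAdaptedChart {m : ℕ} {M : Type*} [TopologicalSpace M]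
    [ChartedSpace (EuclideanSpace ℝ (Fin (m + 2))) M] [IsManifold (𝓡 (m + 2)) ∞ M]
    (g : LorentzianMetric (𝓡 (m + 2)) M) (Z : Π x : M, TangentSpace (𝓡 (m + 2)) x)
    (φ : OpenPartialHomeomorph M (EuclideanSpace ℝ (Fin (m + 2)))) : Prop where
  mem_maximalAtlas : φ ∈ IsManifold.maximalAtlas (𝓡 (m + 2)) ∞ M
  eq_coordVector : ∀ x ∈ φ.source, Z x = coordVector φ 1 x
  eq_grad : ∀ x ∈ φ.source, Z x = g.grad (fun y ↦ φ y 0) x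

end

/-! Everything follows from `Z = ∂_v = grad u`. Since `Z` is a coordinate field, it commutes with
every `∂_σ`. As the connection is torsion-free and `∇Z = 0`, this gives `∇_Z ∂_σ = ∇_{∂_σ} Z = 0`,
and metric compatibility then gives `Z(g_{σρ}) = 0` (`mvfderiv_val_eq_zero_of_parallel`). The row
`g_{vσ}` is read off from `g(Z, ·) = du` (`val_left`).

For positivity, let `w` be a nonzero vector with `du(w) = dv(w) = 0`. Then `g(Z, w) = du(w) = 0`,
and in Lorentzian signature a vector orthogonal to the null vector `Z ≠ 0` is spacelike or
proportional to `Z`. The second case is excluded by `dv(Z) = 1` (`val_self_pos`). This gives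
positive definiteness of `(g_{ab})` as well as of the metric induced on the level sets of `(u, v)`.
Those level sets carry the remaining coordinates as a single global chart, in which the inclusion
becomes `y ↦ (y, 0)` after a translation in the ambient chart. -/

open scoped Topology

namespace LorentzianMetric

/-! ### Null vectors in Lorentzian signature and parallel vector fields -/

section General

variable {E : Type*} [NormedAddCommGroup E] [NormedSpace ℝ E]
  {H : Type*} [TopologicalSpace H] {I : ModelWithCorners ℝ E H}
  {M : Type*} [TopologicalSpace M] [ChartedSpace H M] [IsManifold I ∞ M]
  (g : LorentzianMetric I M)

/-- A vector orthogonal to a nonzero null vector is spacelike or a multiple of that null vector. -/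
lemma val_self_pos_or_exists_smul_of_orthogonal_null {x : M} {z v : TangentSpace I x}
    (hz : z ≠ 0) (hzz : g.val x z z = 0) (hzv : g.val x z v = 0) :
    0 < g.val x v v ∨ ∃ t : ℝ, v = t • z := by
  obtain ⟨k, b, hb⟩ := g.signature x
  have expand : ∀ w : TangentSpace I x,
      g.val x w w = -(b.repr w 0) ^ 2 + ∑ i : Fin k, (b.repr w i.succ) ^ 2 := by
    intro w
    have h : g.val x (∑ i, b.repr w i • b i) (∑ i, b.repr w i • b i) =
        ∑ i, (if i = 0 then -1 else 1) * b.repr w i ^ 2 := by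
      simp only [map_sum, sum_apply, map_smul, smul_apply, hb, smul_eq_mul, mul_ite, mul_zero,
        Finset.sum_ite_eq', Finset.mem_univ, if_true]
      exact Finset.sum_congr rfl fun i _ ↦ by split_ifs <;> ring
    rw [b.sum_repr w, Fin.sum_univ_succ] at h
    simpa [Fin.succ_ne_zero] using h
  -- The metric is positive definite on the span of the spacelike basis vectors.
  have spatial : ∀ w : TangentSpace I x, b.repr w 0 = 0 → g.val x w w ≤ 0 → w = 0 := by
    intro w h0 hw
    rw [expand w, h0] at hw
    have hs : ∑ i : Fin k, (b.repr w i.succ) ^ 2 = 0 :=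
      le_antisymm (by simpa using hw) (Finset.sum_nonneg fun i _ ↦ sq_nonneg _)
    rw [Finset.sum_eq_zero_iff_of_nonneg fun i _ ↦ sq_nonneg _] at hs
    refine b.ext_elem fun i ↦ ?_
    refine Fin.cases ?_ (fun j ↦ ?_) i
    · simpa using h0
    · simpa using hs j (Finset.mem_univ j)
  have hz0 : b.repr z 0 ≠ 0 := fun h ↦ hz (spatial z h hzz.le)
  rw [or_iff_not_imp_left, not_lt]
  intro hv
  -- This ratio cancels the time component of `v - t • z`. As `z` is null and orthogonal to `v`,
  -- that difference has the same square as `v`, which is nonpositive, so `spatial` applies.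
  refine ⟨b.repr v 0 / b.repr z 0, ?_⟩
  rw [← sub_eq_zero]
  apply spatial
  · simp [hz0]
  · have hvz : g.val x v z = 0 := by rw [g.symm, hzv]
    simpa [hzz, hzv, hvz] using hv

variable [FiniteDimensional ℝ E]

lemma val_grad (f : M → ℝ) (x : M) (w : TangentSpace I x) :
    g.val x (g.grad f x) w = d% f x w :=
  g.val_sharp x _ w

/-- A parallel field which commutes with two given fields annihilates their inner product. -/
lemma mvfderiv_val_eq_zero_of_parallel {x : M} {Z X Y : Π x : M, TangentSpace I x}
    (hZ : MDiffAt (T% Z) x) (hX : MDiffAt (T% X) x) (hY : MDiffAt (T% Y) x)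
    (hpar : g.leviCivita Z x = 0)
    (hZX : VectorField.mlieBracket I Z X x = 0) (hZY : VectorField.mlieBracket I Z Y x = 0) :
    d% (fun y ↦ g.val y (X y) (Y y)) x (Z x) = 0 := by
  -- Vanishing torsion reads `∇_Z W - ∇_W Z = [Z, W]`, and two of the three terms are zero.
  have key : ∀ W : Π x : M, TangentSpace I x, MDiffAt (T% W) x →
      VectorField.mlieBracket I Z W x = 0 → g.leviCivita W x (Z x) = 0 := by
    intro W hW hZW
    have h := ((CovariantDerivative.torsion_eq_zero_iff _).1 g.leviCivita_torsion) hZ hW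
    rw [hpar, hZW] at h
    simpa using h
  rw [g.leviCivita_metric hZ hX hY, key X hX hZX, key Y hY hZY]
  simp

end General
end LorentzianMetric

/-! ### Coordinate vector fields of a chart -/

section Coord

variable {n : ℕ} {M : Type*} [TopologicalSpace M] [ChartedSpace (EuclideanSpace ℝ (Fin n)) M]
  {φ : OpenPartialHomeomorph M (EuclideanSpace ℝ (Fin n))}

lemma two_le_infty : (2 : ℕ∞ω) ≤ ∞ := by
  exact WithTop.coe_le_coe.2 (le_top : (2 : ℕ∞) ≤ ⊤)

lemma mdifferentiable_of_mem_maximalAtlas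
    (hφ : φ ∈ IsManifold.maximalAtlas (𝓡 n) ∞ M) : φ.MDifferentiable (𝓡 n) (𝓡 n) :=
  ⟨(contMDiffOn_of_mem_maximalAtlas hφ).mdifferentiableOn (by simp),
    (contMDiffOn_symm_of_mem_maximalAtlas hφ).mdifferentiableOn (by simp)⟩

lemma mfderiv_coordVector (hφ : φ ∈ IsManifold.maximalAtlas (𝓡 n) ∞ M) {x : M}
    (hx : x ∈ φ.source) (σ : Fin n) :
    mfderiv (𝓡 n) (𝓡 n) φ x (coordVector φ σ x) = EuclideanSpace.single σ (1 : ℝ) :=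
  ((mdifferentiable_of_mem_maximalAtlas hφ).mfderiv hx).apply_symm_apply
    (EuclideanSpace.single σ (1 : ℝ) : EuclideanSpace ℝ (Fin n))

lemma mvfderiv_coord (hφ : φ ∈ IsManifold.maximalAtlas (𝓡 n) ∞ M) {x : M}
    (hx : x ∈ φ.source) (i : Fin n) (v : TangentSpace (𝓡 n) x) :
    mvfderiv (𝓡 n) (fun y ↦ φ y i) x v =
      (EuclideanSpace.proj i : EuclideanSpace ℝ (Fin n) →L[ℝ] ℝ)
        (mfderiv (𝓡 n) (𝓡 n) φ x v) := by
  have h : HasMFDerivAt (𝓡 n) 𝓘(ℝ, ℝ) (fun y ↦ φ y i) x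
      ((EuclideanSpace.proj i : EuclideanSpace ℝ (Fin n) →L[ℝ] ℝ).comp
        (mfderiv (𝓡 n) (𝓡 n) φ x)) :=
    (EuclideanSpace.proj i : EuclideanSpace ℝ (Fin n) →L[ℝ] ℝ).hasMFDerivAt.comp x
      ((mdifferentiable_of_mem_maximalAtlas hφ).mdifferentiableAt hx).hasMFDerivAt
  rw [mvfderiv, h.mfderiv]
  rfl

/-- The constant vector field on a Euclidean space. -/
def constVectorField (v : EuclideanSpace ℝ (Fin n)) (y : EuclideanSpace ℝ (Fin n)) :
    TangentSpace (𝓡 n) y := v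

lemma mdifferentiableAt_constVectorField (v y : EuclideanSpace ℝ (Fin n)) :
    MDiffAt (T% (constVectorField v)) y :=
  (contMDiffAt_vectorSpace_iff_contDiffAt (n := 1)
    (V := constVectorField v).2 contDiffAt_const).mdifferentiableAt one_ne_zero

lemma mlieBracket_constVectorField (v w : EuclideanSpace ℝ (Fin n)) :
    VectorField.mlieBracket (𝓡 n) (constVectorField v) (constVectorField w) = 0 := by
  rw [← VectorField.mlieBracketWithin_univ, VectorField.mlieBracketWithin_eq_lieBracketWithin]
  ext1 y
  have h : VectorField.lieBracket ℝ (fun _ : EuclideanSpace ℝ (Fin n) ↦ v) (fun _ ↦ w) y = 0 := by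
    simp [VectorField.lieBracket]
  exact (congrFun VectorField.lieBracketWithin_univ y).trans h

lemma isInvertible_mfderiv_of_mem_maximalAtlas (hφ : φ ∈ IsManifold.maximalAtlas (𝓡 n) ∞ M)
    {x : M} (hx : x ∈ φ.source) : (mfderiv (𝓡 n) (𝓡 n) φ x).IsInvertible :=
  ⟨(mdifferentiable_of_mem_maximalAtlas hφ).mfderiv hx, rfl⟩

/-- Writing `∂_σ` as a pullback of a constant field lets differentiability and Lie brackets be
transferred from Euclidean space. -/
lemma coordVector_eq_mpullback (hφ : φ ∈ IsManifold.maximalAtlas (𝓡 n) ∞ M) {x : M}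
    (hx : x ∈ φ.source) (σ : Fin n) :
    coordVector φ σ x = VectorField.mpullback (𝓡 n) (𝓡 n) φ
      (constVectorField (EuclideanSpace.single σ (1 : ℝ))) x := by
  let e := (mdifferentiable_of_mem_maximalAtlas hφ).mfderiv hx
  have he : mfderiv (𝓡 n) (𝓡 n) φ x =
    (e : TangentSpace (𝓡 n) x →L[ℝ] TangentSpace (𝓡 n) (φ x)) := rfl
  rw [VectorField.mpullback_apply, he, ContinuousLinearMap.inverse_equiv]
  rfl

lemma coordVector_eventuallyEq (hφ : φ ∈ IsManifold.maximalAtlas (𝓡 n) ∞ M) {x : M}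
    (hx : x ∈ φ.source) (σ : Fin n) :
    coordVector φ σ =ᶠ[𝓝 x] VectorField.mpullback (𝓡 n) (𝓡 n) φ
      (constVectorField (EuclideanSpace.single σ (1 : ℝ))) :=
  Filter.eventually_of_mem (φ.open_source.mem_nhds hx) fun _ hy ↦
    coordVector_eq_mpullback hφ hy σ

variable [IsManifold (𝓡 n) ∞ M]

lemma mdifferentiableAt_coordVector (hφ : φ ∈ IsManifold.maximalAtlas (𝓡 n) ∞ M) {x : M}
    (hx : x ∈ φ.source) (σ : Fin n) :
    MDifferentiableAt (𝓡 n) (𝓡 n).tangent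
      (fun y ↦ (⟨y, coordVector φ σ y⟩ : TangentBundle (𝓡 n) M)) x := by
  refine ((mdifferentiableAt_constVectorField (EuclideanSpace.single σ 1) _).mpullback_vectorField
    (contMDiffAt_of_mem_maximalAtlas hφ hx) (isInvertible_mfderiv_of_mem_maximalAtlas hφ hx)
    two_le_infty).congr_of_eventuallyEq ?_
  filter_upwards [coordVector_eventuallyEq hφ hx σ] with y hy
  rw [hy]

/-- The Lie bracket is natural under pullback, and constant fields commute. -/
lemma mlieBracket_coordVector (hφ : φ ∈ IsManifold.maximalAtlas (𝓡 n) ∞ M) {x : M}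
    (hx : x ∈ φ.source) (σ ρ : Fin n) :
    VectorField.mlieBracket (𝓡 n) (coordVector φ σ) (coordVector φ ρ) x = 0 := by
  have : IsManifold (𝓡 n) (minSmoothness ℝ 2) M :=
    IsManifold.of_le (n := ∞) (by simpa using two_le_infty)
  rw [(coordVector_eventuallyEq hφ hx σ).mlieBracket_vectorField_eq
    (coordVector_eventuallyEq hφ hx ρ), ← VectorField.mpullback_mlieBracket
    (mdifferentiableAt_constVectorField _ _) (mdifferentiableAt_constVectorField _ _)
    (contMDiffAt_of_mem_maximalAtlas hφ hx) (by simpa using two_le_infty),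
    mlieBracket_constVectorField, VectorField.mpullback_zero]
  rfl

end Coord

/-! ### Metric components in an adapted chart -/

section Adapted

variable {m : ℕ} {M : Type*} [TopologicalSpace M]
  [ChartedSpace (EuclideanSpace ℝ (Fin (m + 2))) M] [IsManifold (𝓡 (m + 2)) ∞ M]
  {g : LorentzianMetric (𝓡 (m + 2)) M} {Z : Π x : M, TangentSpace (𝓡 (m + 2)) x}
  {φ : OpenPartialHomeomorph M (EuclideanSpace ℝ (Fin (m + 2)))}

namespace IsAdaptedChart

/-- This is `g(Z, ·) = du`, with `du` expressed as the zeroth coordinate of `dφ`. -/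
lemma val_left (hφ : IsAdaptedChart g Z φ) {x : M} (hx : x ∈ φ.source)
    (v : TangentSpace (𝓡 (m + 2)) x) :
    g.val x (Z x) v = (EuclideanSpace.proj 0 : EuclideanSpace ℝ (Fin (m + 2)) →L[ℝ] ℝ)
      (mfderiv (𝓡 (m + 2)) (𝓡 (m + 2)) φ x v) := by
  rw [hφ.eq_grad x hx, g.val_grad, mvfderiv_coord hφ.mem_maximalAtlas hx]

lemma component_one (hφ : IsAdaptedChart g Z φ) {x : M} (hx : x ∈ φ.source) (σ : Fin (m + 2)) :
    g.component φ 1 σ x = if σ = 0 then 1 else 0 := by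
  rw [LorentzianMetric.component, ← hφ.eq_coordVector x hx, hφ.val_left hx,
    mfderiv_coordVector hφ.mem_maximalAtlas hx]
  simp [eq_comm]

lemma mvfderiv_component (hφ : IsAdaptedChart g Z φ)
    (hZ_parallel : ∀ x, g.leviCivita Z x = 0) {x : M} (hx : x ∈ φ.source) (σ ρ : Fin (m + 2)) :
    mvfderiv (𝓡 (m + 2)) (g.component φ σ ρ) x (Z x) = 0 := by
  have hZ : Z =ᶠ[𝓝 x] coordVector φ 1 :=
    Filter.eventually_of_mem (φ.open_source.mem_nhds hx) hφ.eq_coordVector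
  have hb : ∀ τ, VectorField.mlieBracket (𝓡 (m + 2)) Z (coordVector φ τ) x = 0 := fun τ ↦ by
    rw [hZ.mlieBracket_vectorField_eq (Filter.EventuallyEq.refl _ (coordVector φ τ)),
      mlieBracket_coordVector hφ.mem_maximalAtlas hx]
  refine g.mvfderiv_val_eq_zero_of_parallel ?_
    (mdifferentiableAt_coordVector hφ.mem_maximalAtlas hx σ)
    (mdifferentiableAt_coordVector hφ.mem_maximalAtlas hx ρ) (hZ_parallel x) (hb σ) (hb ρ)
  refine (mdifferentiableAt_coordVector hφ.mem_maximalAtlas hx 1).congr_of_eventuallyEq ?_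
  filter_upwards [hZ] with y hy
  rw [hy]

/-- The vanishing of `Z(g_{σρ})` becomes a statement about `∂/∂v` by the chain rule along `φ.symm`.
Differentiability of the component is established separately, so the zero is a genuine derivative
and not a default value. -/
lemma hasLineDerivAt_component (hφ : IsAdaptedChart g Z φ)
    (hZ_parallel : ∀ x, g.leviCivita Z x = 0) {x : M} (hx : x ∈ φ.source) (σ ρ : Fin (m + 2)) :
    HasLineDerivAt ℝ (fun y ↦ g.component φ σ ρ (φ.symm y)) 0 (φ x)
      (EuclideanSpace.single 1 (1 : ℝ)) := by
  have hc : MDifferentiableAt (𝓡 (m + 2)) 𝓘(ℝ, ℝ) (g.component φ σ ρ) x :=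
    g.mdiffAt_val (mdifferentiableAt_coordVector hφ.mem_maximalAtlas hx σ)
      (mdifferentiableAt_coordVector hφ.mem_maximalAtlas hx ρ)
  have hs : MDifferentiableAt (𝓡 (m + 2)) (𝓡 (m + 2)) φ.symm (φ x) :=
    (mdifferentiable_of_mem_maximalAtlas hφ.mem_maximalAtlas).mdifferentiableAt_symm
      (φ.map_source hx)
  have h0 := hφ.mvfderiv_component hZ_parallel hx σ ρ
  rw [hφ.eq_coordVector x hx, mvfderiv] at h0
  -- The chain rule needs the derivative at `φ.symm (φ x)`, which equals `x` only propositionally.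
  have hc' : ∀ y, y = x → HasMFDerivAt (𝓡 (m + 2)) 𝓘(ℝ, ℝ) (g.component φ σ ρ) y
      (mfderiv (𝓡 (m + 2)) 𝓘(ℝ, ℝ) (g.component φ σ ρ) x) := by
    rintro _ rfl
    exact hc.hasMFDerivAt
  have h1 := ((hc' _ (φ.left_inv hx)).comp (φ x) hs.hasMFDerivAt).hasFDerivAt.hasLineDerivAt
    (EuclideanSpace.single 1 (1 : ℝ))
  exact h0 ▸ h1

/-- Nonzero vectors tangent to the level sets of `(u, v)` are spacelike. -/
lemma val_self_pos (hφ : IsAdaptedChart g Z φ) (hZ_null : ∀ x, g.val x (Z x) (Z x) = 0)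
    {x : M} (hx : x ∈ φ.source) {v : TangentSpace (𝓡 (m + 2)) x} (hv : v ≠ 0)
    (h0 : (EuclideanSpace.proj 0 : EuclideanSpace ℝ (Fin (m + 2)) →L[ℝ] ℝ)
      (mfderiv (𝓡 (m + 2)) (𝓡 (m + 2)) φ x v) = 0)
    (h1 : (EuclideanSpace.proj 1 : EuclideanSpace ℝ (Fin (m + 2)) →L[ℝ] ℝ)
      (mfderiv (𝓡 (m + 2)) (𝓡 (m + 2)) φ x v) = 0) : 0 < g.val x v v := by
  have hZ1 : (EuclideanSpace.proj 1 : EuclideanSpace ℝ (Fin (m + 2)) →L[ℝ] ℝ)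
      (mfderiv (𝓡 (m + 2)) (𝓡 (m + 2)) φ x (Z x)) = 1 := by
    rw [hφ.eq_coordVector x hx, mfderiv_coordVector hφ.mem_maximalAtlas hx]
    simp
  have hZ : Z x ≠ 0 := by
    intro h
    rw [h, map_zero] at hZ1
    exact zero_ne_one ((map_zero _).symm.trans hZ1)
  refine (g.val_self_pos_or_exists_smul_of_orthogonal_null hZ (hZ_null x)
    ((hφ.val_left hx v).trans h0)).resolve_right ?_
  rintro ⟨t, rfl⟩
  -- Apply `dv` to `t • Z x`: the result is `t` because `dv(Z) = 1`, and it is zero by `h1`.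
  have ht : t = 0 := by
    rw [map_smul] at h1
    have h2 := ((EuclideanSpace.proj 1 : EuclideanSpace ℝ (Fin (m + 2)) →L[ℝ] ℝ).map_smul t
      (mfderiv (𝓡 (m + 2)) (𝓡 (m + 2)) φ x (Z x))).symm.trans h1
    rw [hZ1] at h2
    simpa using h2
  exact hv (by rw [ht, zero_smul])

/-- The quadratic form of the matrix at `c` is `g(v, v)` for `v = ∑ c_a ∂_a`, a vector killed by
`du` and `dv`. -/
lemma posDef_component (hφ : IsAdaptedChart g Z φ) (hZ_null : ∀ x, g.val x (Z x) (Z x) = 0)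
    {x : M} (hx : x ∈ φ.source) :
    (Matrix.of fun a b : Fin m ↦ g.component φ a.succ.succ b.succ.succ x).PosDef := by
  refine Matrix.PosDef.of_dotProduct_mulVec_pos ?_ ?_
  · ext a b
    simp [LorentzianMetric.component, g.symm x]
  · intro c hc
    let v : TangentSpace (𝓡 (m + 2)) x := ∑ a, c a • coordVector φ a.succ.succ x
    have hev : mfderiv (𝓡 (m + 2)) (𝓡 (m + 2)) φ x v =
        (∑ a, c a • EuclideanSpace.single (Fin.succ (Fin.succ a)) (1 : ℝ) :
          EuclideanSpace ℝ (Fin (m + 2))) := by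
      simp only [v, map_sum, map_smul, mfderiv_coordVector hφ.mem_maximalAtlas hx]
      rfl
    have hcoord : ∀ i : Fin (m + 2),
        (EuclideanSpace.proj i : EuclideanSpace ℝ (Fin (m + 2)) →L[ℝ] ℝ)
          (mfderiv (𝓡 (m + 2)) (𝓡 (m + 2)) φ x v) =
          ∑ a : Fin m, if i = a.succ.succ then c a else 0 := by
      intro i
      rw [hev, map_sum]
      simp
    have hv : v ≠ 0 := by
      rintro h
      apply hc
      ext a
      have := hcoord a.succ.succ
      rw [h, map_zero] at this
      simpa using ((map_zero _).symm.trans this).symm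
    have hpos := hφ.val_self_pos hZ_null hx hv
      ((hcoord 0).trans (by simp [eq_comm, Fin.succ_ne_zero]))
      ((hcoord 1).trans (by
        refine Finset.sum_eq_zero fun a _ ↦ if_neg ?_
        rw [← Fin.succ_zero_eq_one, Fin.succ_inj]
        exact (Fin.succ_ne_zero a).symm))
    have hval : g.val x v v =
        star c ⬝ᵥ (Matrix.of fun a b : Fin m ↦
          g.component φ a.succ.succ b.succ.succ x).mulVec c := by
      simp only [v, map_sum, sum_apply, map_smul, smul_apply, dotProduct, Matrix.mulVec,
        Matrix.of_apply, LorentzianMetric.component, smul_eq_mul, Finset.mul_sum]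
      rw [Finset.sum_comm]
      refine Finset.sum_congr rfl fun a _ ↦ Finset.sum_congr rfl fun b _ ↦ ?_
      simp only [Pi.star_apply, star_trivial]
      ring
    rwa [hval] at hpos

end IsAdaptedChart
end Adapted

/-! ### The Riemannian metric induced by a smooth map -/

section ClmApply

variable {E₁ F H B : Type*} [NormedAddCommGroup E₁] [NormedSpace ℝ E₁] [FiniteDimensional ℝ E₁]
  [NormedAddCommGroup F] [NormedSpace ℝ F]
  {E : Type*} [NormedAddCommGroup E] [NormedSpace ℝ E] [TopologicalSpace H]
  {I : ModelWithCorners ℝ E H} [TopologicalSpace B] [ChartedSpace H B] {n : ℕ∞ω}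

/-- A family of continuous linear maps on a finite-dimensional space is `C^n` at a point if all its
applications are. -/
lemma contMDiffAt_clm_of_forall_apply {f : B → E₁ →L[ℝ] F} {x : B}
    (h : ∀ v, ContMDiffAt I 𝓘(ℝ, F) n (fun y ↦ f y v) x) :
    ContMDiffAt I 𝓘(ℝ, E₁ →L[ℝ] F) n f x := by
  let e₁ : E₁ ≃L[ℝ] (Fin (Module.finrank ℝ E₁) → ℝ) :=
    ContinuousLinearEquiv.ofFinrankEq (Module.finrank_fin_fun ℝ).symm
  -- In a basis of `E₁`, a linear map is the tuple of its values on basis vectors, so smoothness can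
  -- be checked entry by entry.
  let e₂ := (e₁.arrowCongr (1 : F ≃L[ℝ] F)).trans
    (ContinuousLinearEquiv.piRing (Fin (Module.finrank ℝ E₁)))
  rw [← Function.id_comp f, ← e₂.symm_comp_self]
  exact e₂.symm.contDiff.contMDiff.contMDiffAt.comp x
    (contMDiffAt_pi_space.2 fun i ↦ h _)

end ClmApply

/-- The sublevel set of a positive definite bilinear form on a finite-dimensional space is
bounded. -/
lemma isVonNBounded_of_posDef {E : Type*} [NormedAddCommGroup E] [NormedSpace ℝ E]
    [FiniteDimensional ℝ E] (B : E →L[ℝ] E →L[ℝ] ℝ) (hB : ∀ v, v ≠ 0 → 0 < B v v) :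
    Bornology.IsVonNBounded ℝ {v : E | B v v < 1} := by
  rw [NormedSpace.isVonNBounded_iff]
  have hcont : Continuous fun v ↦ B v v := by fun_prop
  rcases (Metric.sphere (0 : E) 1).eq_empty_or_nonempty with hs | hs
  -- An empty unit sphere means the space is zero.
  · have : ∀ v : E, v = 0 := by
      intro v
      by_contra hv
      have : ‖v‖⁻¹ • v ∈ Metric.sphere (0 : E) 1 := by
        simp [norm_smul, hv]
      simp [hs] at this
    exact (Bornology.isBounded_singleton (x := (0 : E))).subset fun v _ ↦ this v
  -- The minimum `B w w` on the compact unit sphere is positive, and homogeneity gives `‖v‖² * B w w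
  -- ≤ B v v`.
  · obtain ⟨w, hw, hmin⟩ := (isCompact_sphere (0 : E) 1).exists_isMinOn hs hcont.continuousOn
    have hw0 : w ≠ 0 := by
      rintro rfl
      simp at hw
    have hc := hB w hw0
    refine Metric.isBounded_iff_subset_closedBall 0 |>.2 ⟨Real.sqrt (1 / B w w), fun v hv ↦ ?_⟩
    rw [mem_closedBall_zero_iff]
    apply Real.le_sqrt_of_sq_le
    rw [le_div_iff₀ hc]
    by_cases hv0 : v = 0
    · simp [hv0]
    have hn : 0 < ‖v‖ := norm_pos_iff.2 hv0
    have hmem : ‖v‖⁻¹ • v ∈ Metric.sphere (0 : E) 1 := by simp [norm_smul, hv0]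
    have h1 : B w w ≤ B (‖v‖⁻¹ • v) (‖v‖⁻¹ • v) := hmin hmem
    simp only [map_smul, smul_apply, smul_eq_mul] at h1
    have h2 : B v v < 1 := hv
    calc ‖v‖ ^ 2 * B w w ≤ ‖v‖ ^ 2 * (‖v‖⁻¹ * (‖v‖⁻¹ * B v v)) := by gcongr
      _ = B v v := by field_simp
      _ ≤ 1 := h2.le

namespace LorentzianMetric

variable {E : Type*} [NormedAddCommGroup E] [NormedSpace ℝ E]
  {H : Type*} [TopologicalSpace H] {I : ModelWithCorners ℝ E H}
  {M : Type*} [TopologicalSpace M] [ChartedSpace H M] [IsManifold I ∞ M]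
  (g : LorentzianMetric I M)
  {E' : Type*} [NormedAddCommGroup E'] [NormedSpace ℝ E']
  {H' : Type*} [TopologicalSpace H'] {J : ModelWithCorners ℝ E' H'}
  {N : Type*} [TopologicalSpace N] [ChartedSpace H' N]

variable (I J) in
/-- The pullback of a Lorentzian metric under a map. -/
noncomputable def pullback (f : N → M) (p : N) : TangentSpace J p →L[ℝ] TangentSpace J p →L[ℝ] ℝ :=
  ContinuousLinearMap.bilinearComp (E := E) (F := E) (E' := E') (F' := E') (G := ℝ)
    (g.val (f p)) (mfderiv J I f p) (mfderiv J I f p)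

variable [IsManifold J ∞ N] [FiniteDimensional ℝ E']

/-- In a trivialization it suffices to test the form on fixed vectors `v`, `w`. These give smooth
local sections, which the tangent map of `f` pushes to smooth fields along `f`, where `g` can be
evaluated. -/
lemma contMDiff_pullback {f : N → M} (hf : ContMDiff J I ∞ f) :
    ContMDiff J (J.prod 𝓘(ℝ, E' →L[ℝ] E' →L[ℝ] ℝ)) ∞
      (fun p ↦ TotalSpace.mk' (E' →L[ℝ] E' →L[ℝ] ℝ)
        (E := fun p : N ↦ TangentSpace J p →L[ℝ] TangentSpace J p →L[ℝ] ℝ) p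
        (g.pullback I J f p)) := by
  intro p₀
  rw [contMDiffAt_hom_bundle]
  refine ⟨contMDiffAt_id, contMDiffAt_clm_of_forall_apply fun v ↦
    contMDiffAt_clm_of_forall_apply fun w ↦ ?_⟩
  let e := trivializationAt E' (TangentSpace J : N → Type _) p₀
  have hp₀ : p₀ ∈ e.baseSet := FiberBundle.mem_baseSet_trivializationAt' p₀
  have hsec : ∀ v : E', ContMDiffAt J J.tangent ∞
      (fun p ↦ (⟨p, e.symm p v⟩ : TangentBundle J N)) p₀ := by
    intro v
    refine (e.contMDiffAt_section_iff hp₀).2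
      ((contMDiffAt_const (c := v)).congr_of_eventuallyEq ?_)
    filter_upwards [e.open_baseSet.mem_nhds hp₀] with p hp
    simp [e.apply_mk_symm hp]
  have hpush : ∀ v : E', ContMDiffAt J I.tangent ∞
      (fun p ↦ (⟨f p, mfderiv J I f p (e.symm p v)⟩ : TangentBundle I M)) p₀ := fun v ↦
    (hf.contMDiff_tangentMap (m := ∞) (by simp)).contMDiffAt.comp p₀ (hsec v)
  have hval : ContMDiffAt J 𝓘(ℝ, ℝ) ∞
      (fun p ↦ g.pullback I J f p (e.symm p v) (e.symm p w)) p₀ := by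
    have h := ContMDiffAt.clm_bundle_apply₂ (F₁ := E) (F₂ := E) (F₃ := ℝ)
      (E₃ := Bundle.Trivial M ℝ)
      (g.contMDiff.contMDiffAt.comp p₀ hf.contMDiffAt) (hpush v) (hpush w)
    exact (contMDiffAt_totalSpace.1 h).2
  refine hval.congr_of_eventuallyEq ?_
  filter_upwards [e.open_baseSet.mem_nhds hp₀] with p hp
  rw [inCoordinates_apply_eq₂ hp hp (Set.mem_univ _)]
  simp [e]

/-- A smooth map along which the pullback of a Lorentzian metric is positive definite induces a
smooth Riemannian metric. -/
noncomputable def inducedRiemannianMetric {f : N → M} (hf : ContMDiff J I ∞ f)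
    (hpos : ∀ (p : N) (v : TangentSpace J p), v ≠ 0 →
      0 < g.val (f p) (mfderiv J I f p v) (mfderiv J I f p v)) :
    ContMDiffRiemannianMetric J ∞ E' (TangentSpace J : N → Type _) where
  inner := g.pullback I J f
  symm _ _ _ := g.symm _ _ _
  pos := hpos
  isVonNBounded p := isVonNBounded_of_posDef (E := E') (g.pullback I J f p) (hpos p)
  contMDiff := g.contMDiff_pullback hf

end LorentzianMetric

/-! ### Level sets of two coordinates as embedded submanifolds -/

/-- Splitting off the first two coordinates of a Euclidean space. -/
noncomputable def headTwoEquiv (m : ℕ) :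
    (EuclideanSpace ℝ (Fin m) × (ℝ × ℝ)) ≃L[ℝ] EuclideanSpace ℝ (Fin (m + 2)) :=
  LinearEquiv.toContinuousLinearEquiv
    { toFun := fun p ↦ WithLp.toLp 2
        (Fin.cons p.2.1 (Fin.cons p.2.2 fun a ↦ p.1 a : Fin (m + 1) → ℝ) : Fin (m + 2) → ℝ)
      invFun := fun q ↦ (WithLp.toLp 2 fun a ↦ q a.succ.succ, (q 0, q 1))
      map_add' := fun p q ↦ by
        ext i
        refine Fin.cases ?_ (fun i ↦ Fin.cases ?_ (fun i ↦ ?_) i) i <;> simp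
      map_smul' := fun c p ↦ by
        ext i
        refine Fin.cases ?_ (fun i ↦ Fin.cases ?_ (fun i ↦ ?_) i) i <;> simp
      left_inv := fun p ↦ by
        refine Prod.ext ?_ (Prod.ext ?_ ?_)
        · ext a; simp
        · simp
        · rfl
      right_inv := fun q ↦ by
        ext i
        refine Fin.cases ?_ (fun i ↦ Fin.cases ?_ (fun i ↦ ?_) i) i <;> simp }

@[simp]
lemma headTwoEquiv_apply_zero {m : ℕ} (p : EuclideanSpace ℝ (Fin m) × (ℝ × ℝ)) :
    headTwoEquiv m p 0 = p.2.1 := rfl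

@[simp]
lemma headTwoEquiv_apply_one {m : ℕ} (p : EuclideanSpace ℝ (Fin m) × (ℝ × ℝ)) :
    headTwoEquiv m p 1 = p.2.2 := rfl

lemma headTwoEquiv_symm_snd {m : ℕ} (q : EuclideanSpace ℝ (Fin (m + 2))) :
    ((headTwoEquiv m).symm q).2 = (q 0, q 1) := rfl

section Slice

variable {m : ℕ} {M : Type*} [TopologicalSpace M]

/-- The level set of the first two coordinates of a chart. -/
abbrev chartSlice (φ : OpenPartialHomeomorph M (EuclideanSpace ℝ (Fin (m + 2)))) (c d : ℝ) :
    Set M := {x ∈ φ.source | φ x 0 = c ∧ φ x 1 = d}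

variable (φ : OpenPartialHomeomorph M (EuclideanSpace ℝ (Fin (m + 2)))) (c d : ℝ)

lemma headTwoEquiv_symm_of_mem_chartSlice {x : M} (hx : x ∈ chartSlice φ c d) :
    headTwoEquiv m (((headTwoEquiv m).symm (φ x)).1, (c, d)) = φ x := by
  have h : (((headTwoEquiv m).symm (φ x)).1, (c, d)) = (headTwoEquiv m).symm (φ x) :=
    Prod.ext rfl (by rw [headTwoEquiv_symm_snd, hx.2.1, hx.2.2])
  rw [h, ContinuousLinearEquiv.apply_symm_apply]

lemma symm_mem_chartSlice {y : EuclideanSpace ℝ (Fin m)}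
    (hy : headTwoEquiv m (y, (c, d)) ∈ φ.target) :
    φ.symm (headTwoEquiv m (y, (c, d))) ∈ chartSlice φ c d := by
  refine ⟨φ.map_target hy, ?_, ?_⟩ <;> rw [φ.right_inv hy] <;> simp

open Classical in
/-- The remaining coordinates as a global chart on a level set of the first two coordinates. -/
noncomputable def sliceChart [Nonempty (chartSlice φ c d)] :
    OpenPartialHomeomorph (chartSlice φ c d) (EuclideanSpace ℝ (Fin m)) where
  toFun p := ((headTwoEquiv m).symm (φ p)).1
  -- Off the target the value is irrelevant, but some point of the slice must exist to serve as one.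
  invFun y := if hy : headTwoEquiv m (y, (c, d)) ∈ φ.target then
    ⟨φ.symm (headTwoEquiv m (y, (c, d))), symm_mem_chartSlice φ c d hy⟩ else Classical.arbitrary _
  source := Set.univ
  target := {y | headTwoEquiv m (y, (c, d)) ∈ φ.target}
  map_source' p _ := by
    rw [Set.mem_ofPred_eq, headTwoEquiv_symm_of_mem_chartSlice φ c d p.2]
    exact φ.map_source p.2.1
  map_target' _ _ := Set.mem_univ _
  left_inv' p _ := by
    have h : headTwoEquiv m (((headTwoEquiv m).symm (φ p)).1, (c, d)) = φ p :=
      headTwoEquiv_symm_of_mem_chartSlice φ c d p.2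
    have ht : headTwoEquiv m (((headTwoEquiv m).symm (φ p)).1, (c, d)) ∈ φ.target :=
      h ▸ φ.map_source p.2.1
    rw [dif_pos ht]
    ext
    simp only [h]
    exact φ.left_inv p.2.1
  right_inv' y hy := by
    have hy' : headTwoEquiv m (y, (c, d)) ∈ φ.target := hy
    simp only [dif_pos hy', φ.right_inv hy', ContinuousLinearEquiv.symm_apply_apply]
  open_source := isOpen_univ
  open_target := φ.open_target.preimage (by fun_prop)
  continuousOn_toFun := by
    refine Continuous.continuousOn ?_
    have h : Continuous fun p : chartSlice φ c d ↦ φ p :=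
      φ.continuousOn.comp_continuous continuous_subtype_val fun p ↦ p.2.1
    exact continuous_fst.comp ((headTwoEquiv m).symm.continuous.comp h)
  continuousOn_invFun := by
    rw [Topology.IsInducing.subtypeVal.continuousOn_iff]
    have h : ContinuousOn (fun y ↦ φ.symm (headTwoEquiv m (y, (c, d))))
        {y | headTwoEquiv m (y, (c, d)) ∈ φ.target} :=
      φ.continuousOn_symm.comp (by fun_prop) fun y hy ↦ hy
    refine h.congr fun y hy ↦ ?_
    have hy' : headTwoEquiv m (y, (c, d)) ∈ φ.target := hy
    simp [dif_pos hy']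

lemma headTwoEquiv_sliceChart [Nonempty (chartSlice φ c d)] (p : chartSlice φ c d) :
    headTwoEquiv m (sliceChart φ c d p, (c, d)) = φ p :=
  headTwoEquiv_symm_of_mem_chartSlice φ c d p.2

variable [ChartedSpace (EuclideanSpace ℝ (Fin (m + 2))) M] {φ}

/-- Post-composing a chart of the maximal atlas with a translation gives another such chart. -/
lemma trans_translation_mem_maximalAtlas {n : ℕ} {M : Type*} [TopologicalSpace M]
    [ChartedSpace (EuclideanSpace ℝ (Fin n)) M]
    {φ : OpenPartialHomeomorph M (EuclideanSpace ℝ (Fin n))}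
    (hφ : φ ∈ IsManifold.maximalAtlas (𝓡 n) ∞ M) (a : EuclideanSpace ℝ (Fin n)) :
    φ.trans (Homeomorph.addRight a).toOpenPartialHomeomorph ∈
      IsManifold.maximalAtlas (𝓡 n) ∞ M := by
  have htrans : ∀ b : EuclideanSpace ℝ (Fin n),
      ContDiffOn ℝ ∞ (fun x : EuclideanSpace ℝ (Fin n) ↦ x + b) Set.univ :=
    fun b ↦ (contDiff_id.add contDiff_const).contDiffOn
  have hT : (Homeomorph.addRight a).toOpenPartialHomeomorph ∈ contDiffGroupoid ∞ (𝓡 n) := by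
    rw [contDiffGroupoid, mem_groupoid_of_pregroupoid]
    constructor
    · simpa [contDiffPregroupoid, Function.comp_def] using htrans a
    · simpa [contDiffPregroupoid, Function.comp_def, Homeomorph.addRight_symm] using htrans (-a)
  rw [IsManifold.mem_maximalAtlas_iff, mem_maximalAtlas_iff] at hφ ⊢
  intro e he
  rw [OpenPartialHomeomorph.trans_symm_eq_symm_trans_symm, OpenPartialHomeomorph.trans_assoc,
    ← OpenPartialHomeomorph.trans_assoc e.symm]
  exact ⟨StructureGroupoid.trans _ (StructureGroupoid.symm _ hT) (hφ e he).1,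
    StructureGroupoid.trans _ (hφ e he).2 hT⟩

/-- A level set of the first two coordinates of a chart is an embedded submanifold of
codimension `2`. -/
lemma exists_chartedSpace_chartSlice (hφ : φ ∈ IsManifold.maximalAtlas (𝓡 (m + 2)) ∞ M) (c d : ℝ) :
    ∃ (_ : ChartedSpace (EuclideanSpace ℝ (Fin m)) (chartSlice φ c d))
      (_ : IsManifold (𝓡 m) ∞ (chartSlice φ c d)),
      Manifold.IsSmoothEmbedding (𝓡 m) (𝓡 (m + 2)) ∞ (Subtype.val : chartSlice φ c d → M) ∧
      ∀ p : chartSlice φ c d, Function.Injective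
        (mfderiv (𝓡 m) (𝓡 (m + 2)) (Subtype.val : chartSlice φ c d → M) p) := by
  rcases isEmpty_or_nonempty (chartSlice φ c d) with hS | hS
  -- `sliceChart` needs a point, so an empty level set is treated separately; all pointwise
  -- conditions are then vacuous.
  · let := ChartedSpace.empty (EuclideanSpace ℝ (Fin m)) (chartSlice φ c d)
    refine ⟨inferInstance, inferInstance, ⟨?_, .subtypeVal⟩, fun p ↦ isEmptyElim p⟩
    exact Manifold.IsImmersionOfComplement.isImmersion (F := ℝ × ℝ) fun p ↦ isEmptyElim p
  let : ChartedSpace (EuclideanSpace ℝ (Fin m)) (chartSlice φ c d) :=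
    (sliceChart φ c d).singletonChartedSpace rfl
  have hman : IsManifold (𝓡 m) ∞ (chartSlice φ c d) :=
    (sliceChart φ c d).isManifold_singleton rfl
  have hatlas : sliceChart φ c d ∈ IsManifold.maximalAtlas (𝓡 m) ∞ (chartSlice φ c d) :=
    IsManifold.subset_maximalAtlas (Set.mem_singleton _)
  have himm : Manifold.IsImmersionOfComplement (ℝ × ℝ) (𝓡 m) (𝓡 (m + 2)) ∞
      (Subtype.val : chartSlice φ c d → M) := by
    intro p
    -- The normal form of an immersion is `y ↦ (y, 0)`, whereas in `φ` the slice is `y ↦ (y, (c,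
    -- d))`. Translating the ambient chart by `-(0, (c, d))` corrects this.
    refine Manifold.IsImmersionAtOfComplement.mk_of_charts (headTwoEquiv m) (sliceChart φ c d)
      (φ.trans (Homeomorph.addRight (-headTwoEquiv m (0, (c, d)))).toOpenPartialHomeomorph)
      (Set.mem_univ _) ?_ hatlas (trans_translation_mem_maximalAtlas hφ _) ?_ ?_
    · simpa using p.2.1
    · intro q _
      simpa using q.2.1
    · intro y hy
      have hy' : y ∈ (sliceChart φ c d).target := by simpa using hy
      have h := headTwoEquiv_sliceChart φ c d ((sliceChart φ c d).symm y)
      rw [(sliceChart φ c d).right_inv hy'] at h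
      have h' : φ ((sliceChart φ c d).symm y) + -headTwoEquiv m (0, (c, d)) =
          headTwoEquiv m (y, 0) := by
        rw [← h, ← map_neg, ← map_add]
        simp
      simpa using h'
  refine ⟨inferInstance, hman, ⟨himm.isImmersion, .subtypeVal⟩, fun p ↦ ?_⟩
  -- The slice chart factors as `proj ∘ φ ∘ Subtype.val`. Its derivative is injective, hence so is
  -- that of the innermost factor.
  have hinj : Function.Injective (mfderiv (𝓡 m) (𝓡 m) (sliceChart φ c d) p) :=
    (mdifferentiable_of_mem_maximalAtlas hatlas).mfderiv_injective (Set.mem_univ p)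
  let proj : EuclideanSpace ℝ (Fin (m + 2)) →L[ℝ] EuclideanSpace ℝ (Fin m) :=
    (ContinuousLinearMap.fst ℝ _ _).comp (headTwoEquiv m).symm.toContinuousLinearMap
  have hφp := ((mdifferentiable_of_mem_maximalAtlas hφ).mdifferentiableAt p.2.1).hasMFDerivAt
  have hι := (himm.contMDiff.mdifferentiable (by simp) p).hasMFDerivAt
  have hcomp := proj.hasMFDerivAt.comp p (hφp.comp p hι)
  have heq : mfderiv (𝓡 m) (𝓡 m) (sliceChart φ c d) p = _ := hcomp.mfderiv
  intro v w hvw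
  apply hinj
  rw [heq]
  exact congrArg (fun z ↦ proj (mfderiv (𝓡 (m + 2)) (𝓡 (m + 2)) φ p z)) hvw

end Slice

/-! ### The induced metric on the level sets of `(u, v)` -/

namespace IsAdaptedChart

variable {m : ℕ} {M : Type*} [TopologicalSpace M]
  [ChartedSpace (EuclideanSpace ℝ (Fin (m + 2))) M] [IsManifold (𝓡 (m + 2)) ∞ M]
  {g : LorentzianMetric (𝓡 (m + 2)) M} {Z : Π x : M, TangentSpace (𝓡 (m + 2)) x}
  {φ : OpenPartialHomeomorph M (EuclideanSpace ℝ (Fin (m + 2)))}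

lemma isRiemannianSubmanifold (hφ : IsAdaptedChart g Z φ)
    (hZ_null : ∀ x, g.val x (Z x) (Z x) = 0) (c d : ℝ) :
    g.IsRiemannianSubmanifold m (chartSlice φ c d) := by
  obtain ⟨_, _, hemb, hinj⟩ := exists_chartedSpace_chartSlice hφ.mem_maximalAtlas c d
  have hι := hemb.contMDiff
  -- A coordinate that is constant on the slice has a differential vanishing on vectors tangent to
  -- it; this is used for `u` and `v`.
  have hcoord : ∀ (i : Fin (m + 2)) (t : ℝ), (∀ q : chartSlice φ c d, φ q i = t) →
      ∀ (p : chartSlice φ c d) (v : TangentSpace (𝓡 m) p),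
      (EuclideanSpace.proj i : EuclideanSpace ℝ (Fin (m + 2)) →L[ℝ] ℝ)
        (mfderiv (𝓡 (m + 2)) (𝓡 (m + 2)) φ p
          (mfderiv (𝓡 m) (𝓡 (m + 2)) (Subtype.val : chartSlice φ c d → M) p v)) = 0 := by
    intro i t ht p v
    have hφp := ((mdifferentiable_of_mem_maximalAtlas
      hφ.mem_maximalAtlas).mdifferentiableAt p.2.1).hasMFDerivAt
    have hιp := (hι.mdifferentiable (by simp) p).hasMFDerivAt
    have hcomp := (EuclideanSpace.proj i : EuclideanSpace ℝ (Fin (m + 2)) →L[ℝ] ℝ).hasMFDerivAt.comp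
      p (hφp.comp p hιp)
    have hfun : (EuclideanSpace.proj i : EuclideanSpace ℝ (Fin (m + 2)) →L[ℝ] ℝ) ∘
        φ ∘ (Subtype.val : chartSlice φ c d → M) = fun _ ↦ t := funext ht
    rw [hfun] at hcomp
    exact DFunLike.congr_fun (hasMFDerivAt_unique hcomp (hasMFDerivAt_const t p)) v
  refine ⟨inferInstance, inferInstance, hemb, g.inducedRiemannianMetric hι fun p v hv ↦ ?_,
    fun p v w ↦ rfl⟩
  -- Injectivity of the differential of the inclusion keeps the image of a nonzero tangent vector
  -- nonzero.
  refine hφ.val_self_pos hZ_null p.2.1 (fun h ↦ hv (hinj p ?_))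
    (hcoord 0 c (fun q ↦ q.2.2.1) p v) (hcoord 1 d (fun q ↦ q.2.2.2) p v)
  rw [h, map_zero]

end IsAdaptedChart

theorem proposition3p2 {m : ℕ} {M : Type*} [TopologicalSpace M]
    [ChartedSpace (EuclideanSpace ℝ (Fin (m + 2))) M] [IsManifold (𝓡 (m + 2)) ∞ M]
    (g : LorentzianMetric (𝓡 (m + 2)) M)
    (Z : Π x : M, TangentSpace (𝓡 (m + 2)) x)
    (hZ_smooth : ContMDiff (𝓡 (m + 2)) (𝓡 (m + 2)).tangent ∞
      (fun x ↦ (⟨x, Z x⟩ : TangentBundle (𝓡 (m + 2)) M)))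
    (hZ_parallel : ∀ x, g.leviCivita Z x = 0)
    (hZ_null : ∀ x, g.val x (Z x) (Z x) = 0)
    (hZ_nontrivial : ∃ x, Z x ≠ 0)
    (φ : OpenPartialHomeomorph M (EuclideanSpace ℝ (Fin (m + 2))))
    (hφ : IsAdaptedChart g Z φ) :
    (∀ x ∈ φ.source, ∀ σ ρ : Fin (m + 2),
      HasLineDerivAt ℝ (fun y ↦ g.component φ σ ρ (φ.symm y)) 0 (φ x)
        (EuclideanSpace.single 1 (1 : ℝ))) ∧
    (∀ x ∈ φ.source, ∀ σ : Fin (m + 2), g.component φ 1 σ x = if σ = 0 then 1 else 0) ∧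
    (∀ x ∈ φ.source,
      (Matrix.of fun a b : Fin m ↦ g.component φ a.succ.succ b.succ.succ x).PosDef) ∧
    (∀ c d : ℝ, g.IsRiemannianSubmanifold m {x ∈ φ.source | φ x 0 = c ∧ φ x 1 = d}) := by
  refine ⟨fun x hx σ ρ ↦ hφ.hasLineDerivAt_component hZ_parallel hx σ ρ,
    fun x hx σ ↦ hφ.component_one hx σ, fun x hx ↦ hφ.posDef_component hZ_null hx,
    fun c d ↦ hφ.isRiemannianSubmanifold hZ_null c d⟩
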